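/- For integers $n \ge 1$ and $k \ge 0$, let $p_k(n)$ be the probability that a random vertex of a random rooted plane tree with $n$ vertices is $k$-protected. Here a rooted plane tree is an unlabeled rooted tree in which the children of every vertex are linearly ordered; the tree is chosen uniformly among the rooted plane trees with $n$ vertices, and the vertex is then chosen uniformly among its $n$ vertices. A leaf is a vertex without children, and a vertex is $k$-protected if at least $k$ downward steps (from a vertex to one of its children) are needed to get from it to any leaf. Then, for every fixed integer $k \ge 0$, $$p_k(n) \sim \frac{3}{4^k+2} \qquad (n \to \infty),$$ that is, $\lim_{n\to\infty} p_k(n) \big/ \frac{3}{4^k+2} = 1$. -/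

import Mathlib

/-- Unlabeled rooted plane trees: a root together with a finite linearly ordered family of
`d` subtrees (`d = 0` gives the tree with a single vertex). -/
inductive PlaneTree : Type
  | node (d : ℕ) (child : Fin d → PlaneTree) : PlaneTree

namespace PlaneTree

/-- The vertices of a plane tree, each given by its address: the root is `[]`, and the vertex
`i :: p` is the vertex with address `p` in the `i`-th subtree of the root (counted from `0`).
Thus the children of `v` are the vertices of the form `v ++ [i]`, and the length of `v` is its
distance from the root. -/
def vertices : PlaneTree → Finset (List ℕ)
  | node _ child =>
      insert [] (Finset.univ.biUnion fun i => (child i).vertices.image fun p => (i : ℕ) :: p)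

/-- A leaf is a vertex without children. -/
def IsLeaf (t : PlaneTree) (v : List ℕ) : Prop :=
  v ∈ t.vertices ∧ ∀ i : ℕ, v ++ [i] ∉ t.vertices

/-- `v` is `k`-protected in `t`: at least `k` downward steps are needed to get from `v` to any
leaf at or below `v`. A vertex `w` lies at or below `v` when `v` is a prefix of `w`, and it is
then reached from `v` by `w.length - v.length` downward steps. -/
def IsProtected (t : PlaneTree) (k : ℕ) (v : List ℕ) : Prop :=
  ∀ w : List ℕ, t.IsLeaf w → v <+: w → v.length + k ≤ w.length

theorem card_vertices_node (d : ℕ) (child : Fin d → PlaneTree) :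
    (node d child).vertices.card = 1 + ∑ i, (child i).vertices.card := by
  rw [vertices, Finset.card_insert_of_notMem (by simp), Finset.card_biUnion, add_comm]
  · congr 1
    refine Finset.sum_congr rfl fun i _ => Finset.card_image_of_injective _ ?_
    intro p q h
    simpa using h
  · intro i _ j _ hij
    refine Finset.disjoint_left.2 ?_
    intro v hi hj
    simp only [Finset.mem_image] at hi hj
    obtain ⟨p, _, rfl⟩ := hi
    obtain ⟨q, _, h⟩ := hj
    simp only [List.cons.injEq] at h
    exact hij (Fin.ext h.1.symm)

theorem card_vertices_pos (t : PlaneTree) : 0 < t.vertices.card := by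
  cases t with
  | node d child => rw [card_vertices_node]; omega

theorem finite_card_vertices_le (n : ℕ) : {t : PlaneTree | t.vertices.card ≤ n}.Finite := by
  induction n with
  | zero =>
    refine Set.finite_empty.subset fun t ht => ?_
    have := t.card_vertices_pos
    simp only [Set.mem_ofPred_eq] at ht
    omega
  | succ n ih =>
    refine ((Set.finite_Iic n).biUnion fun d _ =>
      ((Set.Finite.pi' fun _ : Fin d => ih).image (node d))).subset ?_
    rintro ⟨d, child⟩ ht
    simp only [Set.mem_ofPred_eq, card_vertices_node] at ht
    have hd : d ≤ ∑ i, (child i).vertices.card := by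
      calc d = ∑ _i : Fin d, 1 := by simp
        _ ≤ _ := Finset.sum_le_sum fun i _ => (child i).card_vertices_pos
    simp only [Set.mem_iUnion]
    refine ⟨d, by simp only [Set.mem_Iic]; omega, child, fun i => ?_, rfl⟩
    have := Finset.single_le_sum (f := fun i => (child i).vertices.card)
      (fun _ _ => Nat.zero_le _) (Finset.mem_univ i)
    simp only [Set.mem_ofPred_eq]
    omega

theorem finite_card_vertices_eq (n : ℕ) : {t : PlaneTree | t.vertices.card = n}.Finite :=
  (finite_card_vertices_le n).subset fun _ ht => le_of_eq ht

/-- The finite set of all plane trees with exactly `n` vertices. -/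
noncomputable def ofSize (n : ℕ) : Finset PlaneTree :=
  (finite_card_vertices_eq n).toFinset

open Classical in
/-- The set of `k`-protected vertices of `t`. -/
noncomputable def protectedVertices (t : PlaneTree) (k : ℕ) : Finset (List ℕ) :=
  t.vertices.filter fun v => t.IsProtected k v

/-- The probability that a random vertex of a random plane tree with `n` vertices is
`k`-protected: the tree is uniform among the plane trees with `n` vertices, and the vertex is
uniform among the vertices of that tree. -/
noncomputable def protectedProb (k n : ℕ) : ℝ :=
  ∑ t ∈ ofSize n,
    1 / ((ofSize n).card : ℝ) * (((t.protectedVertices k).card : ℝ) / (t.vertices.card : ℝ))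

end PlaneTree

/-!
Let `T` be the generating function of plane trees by number of vertices, `R k` that of the trees
with a `k`-protected root, and `G k` that of the trees with a marked `k`-protected vertex. Every
tree is either a single vertex or arises by grafting a first subtree onto the root of a smaller
tree. This gives `T = X + T ^ 2` (`treeSeries_eq`), so that `T'` is the inverse of `1 - 2 T`, and
`2 * G k = R k * T' + R k` (`two_mul_vertexSeries`). The probability for trees with `n + 1`
vertices is the coefficient of `X ^ (n + 1)` in `G k` divided by `treeDeriv n`, the coefficient of
`X ^ n` in `T'` (`protectedProb_succ`).

The recurrence `treeDeriv_succ` shows that consecutive coefficients of `T'` have ratio tending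
to `4`, so the terms of the convolution `R k * T'`, divided by `treeDeriv n`, converge one by one to
those of `4 * R k (1 / 4)`. Convergence of the sum follows from Scheffé's lemma
(`tendsto_sum_range_of_le`): for `T` in place of `R k` the total is `treeDeriv (n + 1) / 2`
divided by `treeDeriv n`, which tends to `2 = 4 * T (1 / 4)`, and `R k ≤ T` coefficientwise. The
term `R k` alone is negligible, so the probability tends to `2 * R k (1 / 4)`.

A root is `(k + 1)`-protected when it has children and all of them are `k`-protected, so at
`1 / 4` the values `r k` of `R k` satisfy `r 0 = 1 / 2` and `r (k + 1) = r k / (4 * (1 - r k))`,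
which gives `r k = 3 / (2 * (4 ^ k + 2))` (`evalQuarter_rootSeries`).
-/

namespace PlaneTree

/-! ### Decomposing a plane tree at the first child of its root -/

/-- The plane tree with a single vertex. -/
def leaf : PlaneTree := node 0 Fin.elim0

/-- `graft a b` is the tree `b` with `a` added as a new first subtree of its root. -/
def graft (a : PlaneTree) : PlaneTree → PlaneTree
  | node d c => node (d + 1) (Fin.cons a c)

theorem node_zero (c : Fin 0 → PlaneTree) : node 0 c = leaf :=
  congrArg _ (Subsingleton.elim _ _)

theorem node_succ (d : ℕ) (c : Fin (d + 1) → PlaneTree) :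
    node (d + 1) c = graft (c 0) (node d (Fin.tail c)) := by
  simp [graft, Fin.cons_self_tail]

theorem graft_ne_leaf (a b : PlaneTree) : graft a b ≠ leaf := by
  cases b; simp [graft, leaf]

theorem eq_leaf_or_eq_graft (t : PlaneTree) : t = leaf ∨ ∃ a b, t = graft a b := by
  obtain ⟨d, c⟩ := t
  cases d with
  | zero => exact .inl (node_zero c)
  | succ d => exact .inr ⟨_, _, node_succ d c⟩

theorem graft_inj {a b a' b' : PlaneTree} (h : graft a b = graft a' b') : a = a' ∧ b = b' := by
  obtain ⟨d, c⟩ := b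
  obtain ⟨d', c'⟩ := b'
  simp only [graft, node.injEq, Nat.add_right_cancel_iff] at h
  obtain ⟨rfl, h⟩ := h
  obtain ⟨rfl, rfl⟩ := Fin.cons_inj.1 (eq_of_heq h)
  exact ⟨rfl, rfl⟩

theorem card_vertices_leaf : leaf.vertices.card = 1 := by
  rw [leaf, card_vertices_node]; simp

theorem card_vertices_graft (a b : PlaneTree) :
    (graft a b).vertices.card = a.vertices.card + b.vertices.card := by
  obtain ⟨d, c⟩ := b
  rw [graft, card_vertices_node, card_vertices_node, Fin.sum_univ_succ]
  simp only [Fin.cons_zero, Fin.cons_succ]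
  omega

theorem mem_ofSize {n : ℕ} {t : PlaneTree} : t ∈ ofSize n ↔ t.vertices.card = n := by
  simp [ofSize]

/-- The generating function `∑ₜ f t * X ^ |t|` of a weight `f` on plane trees, where `|t|` is the
number of vertices of `t`. -/
noncomputable def genFun (f : PlaneTree → ℝ) : PowerSeries ℝ :=
  PowerSeries.mk fun n => ∑ t ∈ ofSize n, f t

theorem coeff_genFun (f : PlaneTree → ℝ) (n : ℕ) :
    PowerSeries.coeff n (genFun f) = ∑ t ∈ ofSize n, f t :=
  PowerSeries.coeff_mk _ _

open Finset in
theorem sum_ofSize (f : PlaneTree → ℝ) (n : ℕ) :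
    ∑ t ∈ ofSize n, f t = (if n = 1 then f leaf else 0) +
      ∑ ij ∈ HasAntidiagonal.antidiagonal n, ∑ a ∈ ofSize ij.1, ∑ b ∈ ofSize ij.2, f (graft a b) := by
  classical
  rw [← sum_filter_add_sum_filter_not (ofSize n) (· = leaf)]
  congr 1
  · rw [sum_filter, sum_ite_eq' (ofSize n) leaf]
    simp [mem_ofSize, card_vertices_leaf, eq_comm]
  · simp_rw [← sum_product']
    rw [sum_sigma']
    symm
    refine sum_nbij (fun x => graft x.2.1 x.2.2) ?_ ?_ ?_ (fun _ _ => rfl)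
    · rintro ⟨⟨i, j⟩, a, b⟩ h
      simp only [mem_sigma, HasAntidiagonal.mem_antidiagonal, mem_product, mem_ofSize] at h
      simp only [mem_filter, mem_ofSize, card_vertices_graft]
      exact ⟨by omega, graft_ne_leaf _ _⟩
    · rintro ⟨⟨i, j⟩, a, b⟩ h ⟨⟨i', j'⟩, a', b'⟩ h' e
      simp only [mem_coe, mem_sigma, HasAntidiagonal.mem_antidiagonal, mem_product, mem_ofSize] at h h'
      obtain ⟨rfl, rfl⟩ := graft_inj e
      obtain ⟨-, rfl, rfl⟩ := h
      obtain ⟨-, rfl, rfl⟩ := h'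
      rfl
    · intro t ht
      simp only [coe_filter, Set.mem_ofPred_eq, mem_ofSize] at ht
      obtain rfl | ⟨a, b, rfl⟩ := t.eq_leaf_or_eq_graft
      · exact absurd rfl ht.2
      · refine ⟨⟨(a.vertices.card, b.vertices.card), a, b⟩, ?_, rfl⟩
        simpa [mem_ofSize, card_vertices_graft] using ht.1

/-- A weight that is a sum of two products under grafting has a generating function that is the
corresponding sum of products. -/
theorem genFun_of_graft {f u v u' v' : PlaneTree → ℝ}
    (h : ∀ a b, f (graft a b) = u a * v b + u' a * v' b) :
    genFun f = PowerSeries.C (f leaf) * PowerSeries.X + genFun u * genFun v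
      + genFun u' * genFun v' := by
  ext n
  have hX : PowerSeries.coeff n (PowerSeries.C (f leaf) * PowerSeries.X)
      = if n = 1 then f leaf else 0 := by
    rw [PowerSeries.coeff_C_mul, PowerSeries.coeff_X]; simp
  rw [coeff_genFun, sum_ofSize, map_add, map_add, hX]
  simp only [PowerSeries.coeff_mul, coeff_genFun, h, Finset.sum_add_distrib,
    Finset.sum_mul_sum, add_assoc]

theorem genFun_of_graft_mul {f u v : PlaneTree → ℝ} (h : ∀ a b, f (graft a b) = u a * v b) :
    genFun f = PowerSeries.C (f leaf) * PowerSeries.X + genFun u * genFun v := by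
  rw [genFun_of_graft (u := u) (v := v) (u' := 0) (v' := 0) (by simpa using h)]
  have : genFun 0 = 0 := by ext n; simp [coeff_genFun]
  simp [this]

/-! ### Protected vertices -/

theorem nil_mem_vertices (t : PlaneTree) : [] ∈ t.vertices := by
  cases t; simp [vertices]

theorem cons_mem_vertices_node {d : ℕ} {c : Fin d → PlaneTree} {i : Fin d} {p : List ℕ} :
    (i : ℕ) :: p ∈ (node d c).vertices ↔ p ∈ (c i).vertices := by
  simp only [vertices, Finset.mem_insert, reduceCtorEq, Finset.mem_biUnion, Finset.mem_univ,
    Finset.mem_image, List.cons.injEq, true_and, false_or]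
  constructor
  · rintro ⟨j, q, hq, hj, rfl⟩
    rwa [← Fin.ext hj]
  · exact fun h => ⟨i, p, h, rfl, rfl⟩

theorem isLeaf_cons_node {d : ℕ} {c : Fin d → PlaneTree} {i : Fin d} {p : List ℕ} :
    (node d c).IsLeaf ((i : ℕ) :: p) ↔ (c i).IsLeaf p := by
  simp only [IsLeaf, List.cons_append, cons_mem_vertices_node]

theorem exists_cons_of_mem_vertices_node {d : ℕ} {c : Fin d → PlaneTree} {v : List ℕ}
    (h : v ∈ (node d c).vertices) : v = [] ∨ ∃ (i : Fin d) (p : List ℕ), v = (i : ℕ) :: p := by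
  simp only [vertices, Finset.mem_insert, Finset.mem_biUnion, Finset.mem_univ,
    Finset.mem_image, true_and] at h
  obtain h | ⟨i, p, -, h⟩ := h
  exacts [.inl h, .inr ⟨i, p, h.symm⟩]

theorem isLeaf_nil_node {d : ℕ} {c : Fin d → PlaneTree} : (node d c).IsLeaf [] ↔ d = 0 := by
  constructor
  · intro h
    by_contra hd
    exact h.2 0 ((cons_mem_vertices_node (i := ⟨0, Nat.pos_of_ne_zero hd⟩)).2
      (nil_mem_vertices _))
  · rintro rfl
    refine ⟨nil_mem_vertices _, fun i hi => ?_⟩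
    obtain h | ⟨j, -⟩ := exists_cons_of_mem_vertices_node hi
    · simp at h
    · exact j.elim0

theorem isProtected_cons_node {d : ℕ} {c : Fin d → PlaneTree} {i : Fin d} {p : List ℕ} {k : ℕ} :
    (node d c).IsProtected k ((i : ℕ) :: p) ↔ (c i).IsProtected k p := by
  constructor
  · intro h w hw hp
    have := h (i :: w) (isLeaf_cons_node.2 hw) (List.cons_prefix_cons.2 ⟨rfl, hp⟩)
    simp only [List.length_cons] at this
    omega
  · rintro h w hw ⟨q, rfl⟩
    rw [List.cons_append, isLeaf_cons_node] at hw
    have := h _ hw ⟨q, rfl⟩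
    simp only [List.length_cons, List.length_append] at this ⊢
    omega

/-- Every child of the root of the tree is `k`-protected. -/
def ChildrenProtected (k : ℕ) : PlaneTree → Prop
  | node _ c => ∀ i, (c i).IsProtected k []

theorem childrenProtected_leaf (k : ℕ) : leaf.ChildrenProtected k := fun i => i.elim0

theorem childrenProtected_graft {k : ℕ} {a b : PlaneTree} :
    (graft a b).ChildrenProtected k ↔ a.IsProtected k [] ∧ b.ChildrenProtected k := by
  obtain ⟨d, c⟩ := b
  simp [graft, ChildrenProtected, Fin.forall_fin_succ]

theorem isProtected_zero (t : PlaneTree) (v : List ℕ) : t.IsProtected 0 v :=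
  fun _ _ h => h.length_le

theorem isProtected_succ_nil {k : ℕ} {t : PlaneTree} :
    t.IsProtected (k + 1) [] ↔ t ≠ leaf ∧ t.ChildrenProtected k := by
  obtain ⟨d, c⟩ := t
  constructor
  · refine fun h => ⟨fun e => ?_, fun i w hw _ => ?_⟩
    · rw [e] at h
      have := h [] (isLeaf_nil_node.2 rfl) (List.prefix_refl _)
      simp at this
    · have := h (i :: w) (isLeaf_cons_node.2 hw) List.nil_prefix
      simpa using this
  · rintro ⟨h, hc⟩ w hw -
    obtain rfl | ⟨i, p, rfl⟩ := exists_cons_of_mem_vertices_node hw.1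
    · obtain rfl := isLeaf_nil_node.1 hw
      exact absurd (node_zero c) h
    · have := hc i p (isLeaf_cons_node.1 hw) List.nil_prefix
      simpa using this

/-- The number of `k`-protected vertices of the tree other than its root. -/
noncomputable def protectedBelow (k : ℕ) : PlaneTree → ℕ
  | node _ c => ∑ i, ((c i).protectedVertices k).card

theorem protectedBelow_leaf (k : ℕ) : leaf.protectedBelow k = 0 := by
  simp [leaf, protectedBelow]

theorem protectedBelow_graft (k : ℕ) (a b : PlaneTree) :
    (graft a b).protectedBelow k = (a.protectedVertices k).card + b.protectedBelow k := by
  obtain ⟨d, c⟩ := b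
  simp [graft, protectedBelow, Fin.sum_univ_succ]

open Classical in
theorem card_protectedVertices (k : ℕ) (t : PlaneTree) :
    (t.protectedVertices k).card = (if t.IsProtected k [] then 1 else 0) + t.protectedBelow k := by
  obtain ⟨d, c⟩ := t
  have hroot : ∀ s : Finset (Fin d), [] ∉ s.biUnion fun i =>
      ((c i).protectedVertices k).image fun p => (i : ℕ) :: p := by simp
  have hcard : (Finset.univ.biUnion fun i =>
      ((c i).protectedVertices k).image fun p => (i : ℕ) :: p).card
        = (node d c).protectedBelow k := by
    rw [Finset.card_biUnion]
    · exact Finset.sum_congr rfl fun i _ => Finset.card_image_of_injective _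
        fun p q h => (List.cons.inj h).2
    · intro i _ j _ hij
      refine Finset.disjoint_left.2 fun v hi hj => ?_
      simp only [Finset.mem_image] at hi hj
      obtain ⟨p, _, rfl⟩ := hi
      obtain ⟨q, _, h⟩ := hj
      exact hij (Fin.ext (List.cons.inj h).1.symm)
  have hfilter : (Finset.univ.biUnion fun i => (c i).vertices.image fun p => (i : ℕ) :: p).filter
      (fun v => (node d c).IsProtected k v) = Finset.univ.biUnion fun i =>
        ((c i).protectedVertices k).image fun p => (i : ℕ) :: p := by
    rw [Finset.filter_biUnion]
    simp only [Finset.filter_image, isProtected_cons_node, protectedVertices]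
  rw [protectedVertices, vertices, Finset.filter_insert, hfilter]
  split_ifs
  · rw [Finset.card_insert_of_notMem (hroot _), hcard, add_comm]
  · rw [hcard, zero_add]

/-! ### Functional equations of the generating functions -/

/-- The generating function of all plane trees. -/
noncomputable def treeSeries : PowerSeries ℝ := genFun 1

open Classical in
/-- The generating function of the plane trees with a `k`-protected root. -/
noncomputable def rootSeries (k : ℕ) : PowerSeries ℝ :=
  genFun fun t => if t.IsProtected k [] then 1 else 0

open Classical in
/-- The generating function of the plane trees in which all children of the root are
`k`-protected. -/
noncomputable def childrenSeries (k : ℕ) : PowerSeries ℝ :=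
  genFun fun t => if t.ChildrenProtected k then 1 else 0

/-- The generating function of the plane trees with a marked `k`-protected vertex. -/
noncomputable def vertexSeries (k : ℕ) : PowerSeries ℝ :=
  genFun fun t => (t.protectedVertices k).card

theorem treeSeries_eq : treeSeries = PowerSeries.X + treeSeries * treeSeries := by
  conv_lhs => rw [treeSeries, genFun_of_graft_mul (u := 1) (v := 1) (by simp)]
  simp [treeSeries]

theorem rootSeries_zero : rootSeries 0 = treeSeries := by
  simp only [rootSeries, isProtected_zero, if_true, treeSeries]
  rfl

theorem childrenSeries_eq (k : ℕ) :
    childrenSeries k = PowerSeries.X + rootSeries k * childrenSeries k := by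
  classical
  conv_lhs =>
    rw [childrenSeries, genFun_of_graft_mul (u := fun t => if t.IsProtected k [] then 1 else 0)
      (v := fun t => if t.ChildrenProtected k then 1 else 0)
      (by intro a b; simp only [childrenProtected_graft]; split_ifs <;> simp_all)]
  simp [childrenSeries, rootSeries, childrenProtected_leaf]

theorem childrenSeries_eq_X_add_rootSeries_succ (k : ℕ) :
    childrenSeries k = PowerSeries.X + rootSeries (k + 1) := by
  classical
  ext n
  have hX : PowerSeries.coeff n (PowerSeries.X : PowerSeries ℝ)
      = ∑ t ∈ ofSize n, if t = leaf then 1 else 0 := by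
    rw [Finset.sum_ite_eq' (ofSize n) leaf, PowerSeries.coeff_X]
    simp [mem_ofSize, card_vertices_leaf, eq_comm]
  rw [map_add, hX, childrenSeries, rootSeries, coeff_genFun, coeff_genFun,
    ← Finset.sum_add_distrib]
  refine Finset.sum_congr rfl fun t _ => ?_
  by_cases h : t = leaf
  · simp [h, isProtected_succ_nil, childrenProtected_leaf]
  · simp [h, isProtected_succ_nil]

open PowerSeries in
theorem derivative_treeSeries :
    d⁄dX ℝ treeSeries = 1 + 2 * treeSeries * d⁄dX ℝ treeSeries := by
  have h := congrArg (d⁄dX ℝ) treeSeries_eq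
  simp only [map_add, Derivation.leibniz, derivative_X, smul_eq_mul] at h
  linear_combination h

open PowerSeries in
/-- A tree with a marked vertex consists of the subtree at that vertex and its complement; hence
the series is `rootSeries k` times a series that does not depend on `k`, namely half of one plus
the derivative of `treeSeries`. -/
theorem two_mul_vertexSeries (k : ℕ) :
    2 * vertexSeries k = rootSeries k * d⁄dX ℝ treeSeries + rootSeries k := by
  classical
  set H : PowerSeries ℝ := genFun fun t => (t.protectedBelow k : ℝ) with hH
  have h1 : vertexSeries k = rootSeries k + H := by
    ext n
    simp only [vertexSeries, rootSeries, H, map_add, coeff_genFun, ← Finset.sum_add_distrib,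
      card_protectedVertices, Nat.cast_add, Nat.cast_ite, Nat.cast_one, Nat.cast_zero]
  have h2 : H = vertexSeries k * treeSeries + treeSeries * H := by
    conv_lhs =>
      rw [hH, genFun_of_graft (u := fun t => ((t.protectedVertices k).card : ℝ)) (v := 1) (u' := 1)
        (v' := fun t => (t.protectedBelow k : ℝ)) (by simp [protectedBelow_graft])]
    simp [protectedBelow_leaf, treeSeries, vertexSeries, H]
  have h3 := derivative_treeSeries
  rw [h1] at h2 ⊢
  -- `h2` reads `H (1 - 2T) = R T`, and `h3` says that `T'` is the inverse of `1 - 2T`.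
  linear_combination (2 * d⁄dX ℝ treeSeries) * h2 - (2 * H + rootSeries k) * h3

/-! ### The coefficients of the derivative of the tree series -/

/-- The coefficients of the derivative of `treeSeries`: `treeDeriv n` is the number of plane trees
with `n + 1` vertices, one of which is marked. -/
noncomputable def treeDeriv (n : ℕ) : ℝ :=
  PowerSeries.coeff n (PowerSeries.derivative ℝ treeSeries)

theorem treeDeriv_eq (n : ℕ) :
    treeDeriv n = PowerSeries.coeff (n + 1) treeSeries * (n + 1) := by
  rw [treeDeriv, PowerSeries.coeff_derivative]

theorem two_eq_C : (2 : PowerSeries ℝ) = PowerSeries.C 2 := (map_ofNat PowerSeries.C 2).symm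

open PowerSeries in
/-- The recurrence of the central binomial coefficients, read off from `(1 - 4 X) T'' = 2 T'`. -/
theorem treeDeriv_succ (n : ℕ) : (n + 1) * treeDeriv (n + 1) = (4 * n + 2) * treeDeriv n := by
  have h1 := treeSeries_eq
  have h2 := derivative_treeSeries
  have h3 : d⁄dX ℝ treeSeries * (1 - 4 * X) = 1 - 2 * treeSeries := by
    linear_combination (1 - 2 * treeSeries) * h2 + (4 * d⁄dX ℝ treeSeries) * h1
  have h4 : d⁄dX ℝ (d⁄dX ℝ treeSeries) = 4 * (d⁄dX ℝ (d⁄dX ℝ treeSeries) * X)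
      + 2 * d⁄dX ℝ treeSeries := by
    have h := congrArg (d⁄dX ℝ) h3
    have e4 : d⁄dX ℝ (4 : PowerSeries ℝ) = 0 := by
      simpa using (d⁄dX ℝ).map_natCast 4
    have e2 : d⁄dX ℝ (2 : PowerSeries ℝ) = 0 := by
      simpa using (d⁄dX ℝ).map_natCast 2
    simp only [map_sub, Derivation.leibniz, derivative_X, smul_eq_mul, e4, e2,
      Derivation.map_one_eq_zero] at h
    linear_combination h
  have h5 := congrArg (coeff n) h4
  have e4 : (4 : PowerSeries ℝ) = C 4 := (map_ofNat C 4).symm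
  rw [e4, two_eq_C, map_add, coeff_C_mul, coeff_C_mul] at h5
  cases n with
  | zero =>
    rw [coeff_derivative, coeff_zero_mul_X] at h5
    simp only [treeDeriv]
    push_cast at *
    linear_combination h5
  | succ n =>
    rw [coeff_derivative (d⁄dX ℝ treeSeries) (n + 1), coeff_succ_mul_X,
      coeff_derivative (d⁄dX ℝ treeSeries) n] at h5
    simp only [treeDeriv]
    push_cast at *
    linear_combination h5

theorem coeff_zero_genFun (f : PlaneTree → ℝ) : PowerSeries.coeff 0 (genFun f) = 0 := by
  rw [coeff_genFun]
  refine Finset.sum_eq_zero fun t ht => ?_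
  have := t.card_vertices_pos
  rw [mem_ofSize] at ht
  omega

theorem treeDeriv_zero : treeDeriv 0 = 1 := by
  have h := congrArg (PowerSeries.coeff 0) derivative_treeSeries
  have h0 : PowerSeries.coeff 0 treeSeries = 0 := coeff_zero_genFun _
  rw [mul_assoc, two_eq_C, map_add, PowerSeries.coeff_C_mul, PowerSeries.coeff_mul,
    Finset.HasAntidiagonal.antidiagonal_zero, Finset.sum_singleton, h0] at h
  simpa [treeDeriv] using h

theorem treeDeriv_pos (n : ℕ) : 0 < treeDeriv n := by
  induction n with
  | zero => rw [treeDeriv_zero]; exact one_pos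
  | succ n ih =>
    have h := treeDeriv_succ n
    have : 0 < ((n : ℝ) + 1) * treeDeriv (n + 1) := by rw [h]; positivity
    exact pos_of_mul_pos_right this (by positivity)

open Filter Topology

theorem tendsto_treeDeriv_succ_div :
    Tendsto (fun n => treeDeriv (n + 1) / treeDeriv n) atTop (𝓝 4) := by
  have h : ∀ n : ℕ, treeDeriv (n + 1) / treeDeriv n = 4 - 2 * (1 / ((n : ℝ) + 1)) := by
    intro n
    have := (treeDeriv_pos n).ne'
    have hn : (n : ℝ) + 1 ≠ 0 := by positivity
    field_simp
    linear_combination treeDeriv_succ n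
  simp only [h]
  simpa using (tendsto_one_div_add_atTop_nhds_zero_nat (𝕜 := ℝ)).const_mul 2 |>.const_sub 4

theorem tendsto_treeDeriv_sub_div (i : ℕ) :
    Tendsto (fun n => treeDeriv (n - i) / treeDeriv n) atTop (𝓝 ((1 / 4) ^ i)) := by
  rw [← tendsto_add_atTop_iff_nat i]
  simp only [Nat.add_sub_cancel]
  induction i with
  | zero => simp [(treeDeriv_pos _).ne']
  | succ i ih =>
    have h := (tendsto_treeDeriv_succ_div.comp (tendsto_add_atTop_nat i)).inv₀ (by norm_num)
    have h' : Tendsto (fun n => treeDeriv (n + i) / treeDeriv (n + i + 1)) atTop (𝓝 (1 / 4)) := by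
      simpa [Function.comp_def] using h
    rw [pow_succ]
    refine (ih.mul h').congr fun n => ?_
    have h1 := (treeDeriv_pos (n + i)).ne'
    rw [← add_assoc]
    field_simp

/-! ### Values of the series at `1 / 4` -/

theorem coeff_treeSeries_nonneg (n : ℕ) : 0 ≤ PowerSeries.coeff n treeSeries := by
  rw [treeSeries, coeff_genFun]
  exact Finset.sum_nonneg fun _ _ => zero_le_one

theorem summable_treeSeries :
    Summable fun n => PowerSeries.coeff n treeSeries * (1 / 4 : ℝ) ^ n := by
  rw [← summable_nat_add_iff 1]
  -- The terms telescope: each is half the decrement of `treeDeriv n / 4 ^ n`.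
  have key : ∀ n, ∑ i ∈ Finset.range n,
      PowerSeries.coeff (i + 1) treeSeries * (1 / 4 : ℝ) ^ (i + 1)
        = (1 - treeDeriv n * (1 / 4) ^ n) / 2 := by
    intro n
    induction n with
    | zero => simp [treeDeriv_zero]
    | succ n ih =>
      rw [Finset.sum_range_succ, ih]
      have h1 := treeDeriv_succ n
      have h2 := treeDeriv_eq n
      have hn : (n : ℝ) + 1 ≠ 0 := by positivity
      rw [← mul_right_inj' hn, pow_succ]
      linear_combination (1 / 8 * (1 / 4 : ℝ) ^ n) * h1 - (1 / 4 * (1 / 4 : ℝ) ^ n) * h2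
  refine summable_of_sum_range_le (c := 1 / 2)
    (fun n => mul_nonneg (coeff_treeSeries_nonneg _) (by positivity)) fun n => ?_
  rw [key]
  have := treeDeriv_pos n
  have : 0 < treeDeriv n * (1 / 4) ^ n := by positivity
  linarith

/-- The value at `1 / 4` of a power series; junk if the series does not converge there. -/
noncomputable def evalQuarter (f : PowerSeries ℝ) : ℝ :=
  ∑' n, PowerSeries.coeff n f * (1 / 4) ^ n

/-- Coefficientwise `0 ≤ f ≤ treeSeries`. -/
def Dominated (f : PowerSeries ℝ) : Prop :=
  ∀ n, 0 ≤ PowerSeries.coeff n f ∧ PowerSeries.coeff n f ≤ PowerSeries.coeff n treeSeries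

theorem dominated_treeSeries : Dominated treeSeries := fun n => ⟨coeff_treeSeries_nonneg n, le_rfl⟩

theorem dominated_genFun {f : PlaneTree → ℝ} (h0 : ∀ t, 0 ≤ f t) (h1 : ∀ t, f t ≤ 1) :
    Dominated (genFun f) := fun n => by
  rw [treeSeries, coeff_genFun, coeff_genFun]
  exact ⟨Finset.sum_nonneg fun t _ => h0 t, Finset.sum_le_sum fun t _ => h1 t⟩

theorem dominated_rootSeries (k : ℕ) : Dominated (rootSeries k) :=
  dominated_genFun (fun t => by split_ifs <;> norm_num) (fun t => by split_ifs <;> norm_num)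

theorem dominated_childrenSeries (k : ℕ) : Dominated (childrenSeries k) :=
  dominated_genFun (fun t => by split_ifs <;> norm_num) (fun t => by split_ifs <;> norm_num)

theorem Dominated.summable {f : PowerSeries ℝ} (hf : Dominated f) :
    Summable fun n => PowerSeries.coeff n f * (1 / 4 : ℝ) ^ n :=
  summable_treeSeries.of_nonneg_of_le (fun n => mul_nonneg (hf n).1 (by positivity))
    fun n => mul_le_mul_of_nonneg_right (hf n).2 (by positivity)

theorem hasSum_X : HasSum (fun n => PowerSeries.coeff n (PowerSeries.X : PowerSeries ℝ) *
    (1 / 4 : ℝ) ^ n) (1 / 4) := by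
  convert hasSum_ite_eq 1 (1 / 4 : ℝ) using 2 with n
  rw [PowerSeries.coeff_X]
  split_ifs with h <;> simp [h]

theorem evalQuarter_X_add {f : PowerSeries ℝ}
    (hf : Summable fun n => PowerSeries.coeff n f * (1 / 4 : ℝ) ^ n) :
    evalQuarter (PowerSeries.X + f) = 1 / 4 + evalQuarter f := by
  simp only [evalQuarter, map_add, add_mul]
  exact (hasSum_X.add hf.hasSum).tsum_eq

theorem hasSum_mul {f g : PowerSeries ℝ} (hf : Dominated f) (hg : Dominated g) :
    HasSum (fun n => PowerSeries.coeff n (f * g) * (1 / 4 : ℝ) ^ n)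
      (evalQuarter f * evalQuarter g) := by
  have h : ∀ n, PowerSeries.coeff n (f * g) * (1 / 4 : ℝ) ^ n =
      ∑ ij ∈ Finset.HasAntidiagonal.antidiagonal n, (PowerSeries.coeff ij.1 f * (1 / 4 : ℝ) ^ ij.1) *
        (PowerSeries.coeff ij.2 g * (1 / 4 : ℝ) ^ ij.2) := by
    intro n
    rw [PowerSeries.coeff_mul, Finset.sum_mul]
    refine Finset.sum_congr rfl fun ij hij => ?_
    rw [← Finset.HasAntidiagonal.mem_antidiagonal.1 hij, pow_add]
    ring
  simp only [h, evalQuarter]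
  rw [tsum_mul_tsum_eq_tsum_sum_antidiagonal_of_summable_norm hf.summable.norm hg.summable.norm]
  exact (summable_norm_sum_mul_antidiagonal_of_summable_norm
    hf.summable.norm hg.summable.norm).of_norm.hasSum

theorem evalQuarter_treeSeries : evalQuarter treeSeries = 1 / 2 := by
  have hm := hasSum_mul dominated_treeSeries dominated_treeSeries
  have h := congrArg evalQuarter treeSeries_eq
  rw [evalQuarter_X_add hm.summable] at h
  have h' : evalQuarter (treeSeries * treeSeries) = _ := hm.tsum_eq
  rw [h'] at h
  -- The quadratic equation has a double root.
  have : (evalQuarter treeSeries - 1 / 2) ^ 2 = 0 := by linear_combination -h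
  linarith [pow_eq_zero_iff (two_ne_zero) |>.1 this]

theorem evalQuarter_rootSeries (k : ℕ) : evalQuarter (rootSeries k) = 3 / (2 * (4 ^ k + 2)) := by
  induction k with
  | zero => rw [rootSeries_zero, evalQuarter_treeSeries]; norm_num
  | succ k ih =>
    have hm := hasSum_mul (dominated_rootSeries k) (dominated_childrenSeries k)
    have h := congrArg evalQuarter (childrenSeries_eq k)
    rw [evalQuarter_X_add hm.summable] at h
    have h' : evalQuarter (rootSeries k * childrenSeries k) = _ := hm.tsum_eq
    have h2 := congrArg evalQuarter (childrenSeries_eq_X_add_rootSeries_succ k)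
    rw [evalQuarter_X_add (dominated_rootSeries _).summable] at h2
    rw [h', h2, ih] at h
    have hk : (0 : ℝ) < 4 ^ k := by positivity
    rw [eq_div_iff (by positivity), pow_succ]
    field_simp at h
    linear_combination h

/-! ### Convergence of the convolutions -/

/-- Fatou's lemma for sums over initial segments. -/
theorem eventually_lt_sum_range {a : ℕ → ℕ → ℝ} {l : ℕ → ℝ} {L r : ℝ} (ha : ∀ n i, 0 ≤ a n i)
    (hl : ∀ i, Tendsto (fun n => a n i) atTop (𝓝 (l i))) (hL : HasSum l L) (hr : r < L) :
    ∀ᶠ n in atTop, r < ∑ i ∈ Finset.range (n + 1), a n i := by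
  obtain ⟨M, hM⟩ := (hL.tendsto_sum_nat.eventually (lt_mem_nhds hr)).exists
  filter_upwards [(tendsto_finsetSum (Finset.range M) fun i _ => hl i).eventually (lt_mem_nhds hM),
    eventually_ge_atTop M] with n h1 h2
  exact h1.trans_le (Finset.sum_le_sum_of_subset_of_nonneg
    (Finset.range_subset_range.2 (by omega)) fun i _ _ => ha n i)

/-- Scheffé's lemma for sums over initial segments: if the total masses of the dominating terms
`b` converge to the mass of the limit, no mass of the terms `a` escapes either. -/
theorem tendsto_sum_range_of_le {a b : ℕ → ℕ → ℝ} {l m : ℕ → ℝ} {L M : ℝ}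
    (ha : ∀ n i, 0 ≤ a n i) (hab : ∀ n i, a n i ≤ b n i)
    (hl : ∀ i, Tendsto (fun n => a n i) atTop (𝓝 (l i)))
    (hm : ∀ i, Tendsto (fun n => b n i) atTop (𝓝 (m i)))
    (hL : HasSum l L) (hM : HasSum m M)
    (htot : Tendsto (fun n => ∑ i ∈ Finset.range (n + 1), b n i) atTop (𝓝 M)) :
    Tendsto (fun n => ∑ i ∈ Finset.range (n + 1), a n i) atTop (𝓝 L) := by
  refine tendsto_order.2 ⟨fun r hr => eventually_lt_sum_range ha hl hL hr, fun r hr => ?_⟩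
  have h1 := eventually_lt_sum_range (a := fun n i => b n i - a n i) (r := M - L - (r - L) / 2)
    (fun n i => sub_nonneg.2 (hab n i)) (fun i => (hm i).sub (hl i)) (hM.sub hL) (by linarith)
  filter_upwards [h1, htot.eventually (gt_mem_nhds (show M < M + (r - L) / 2 by linarith))]
    with n h2 h3
  rw [Finset.sum_sub_distrib] at h2
  linarith

theorem coeff_succ_mul_derivative {f : PowerSeries ℝ} (h0 : PowerSeries.coeff 0 f = 0) (n : ℕ) :
    PowerSeries.coeff (n + 1) (f * PowerSeries.derivative ℝ treeSeries)
      = ∑ i ∈ Finset.range (n + 1), PowerSeries.coeff (i + 1) f * treeDeriv (n - i) := by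
  rw [PowerSeries.coeff_mul, Finset.Nat.sum_antidiagonal_eq_sum_range_succ_mk,
    Finset.sum_range_succ', h0, zero_mul, add_zero]
  exact Finset.sum_congr rfl fun i _ => by rw [treeDeriv, Nat.add_sub_add_right]

theorem hasSum_coeff_succ {f : PowerSeries ℝ} (hf : Dominated f)
    (h0 : PowerSeries.coeff 0 f = 0) :
    HasSum (fun i => PowerSeries.coeff (i + 1) f * (1 / 4 : ℝ) ^ i) (4 * evalQuarter f) := by
  have h := ((hasSum_nat_add_iff' 1).2 hf.summable.hasSum).mul_left 4
  simp only [Finset.sum_range_one, h0, zero_mul, sub_zero] at h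
  exact h.congr_fun fun i => by rw [pow_succ]; ring

/-- The limit is the one obtained by passing to the limit in each term of the convolution. -/
theorem tendsto_coeff_mul_derivative (k : ℕ) :
    Tendsto (fun n => PowerSeries.coeff (n + 1)
      (rootSeries k * PowerSeries.derivative ℝ treeSeries) / treeDeriv n) atTop
      (𝓝 (4 * evalQuarter (rootSeries k))) := by
  have hpos := fun n => treeDeriv_pos n
  have h0 : PowerSeries.coeff 0 (rootSeries k) = 0 := coeff_zero_genFun _
  have h0' : PowerSeries.coeff 0 treeSeries = 0 := coeff_zero_genFun _
  have htot : Tendsto (fun n => PowerSeries.coeff (n + 1)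
      (treeSeries * PowerSeries.derivative ℝ treeSeries) / treeDeriv n) atTop
      (𝓝 (4 * evalQuarter treeSeries)) := by
    -- By `2 T T' = T' - 1` the total for `treeSeries` is known exactly.
    have h : ∀ n, PowerSeries.coeff (n + 1)
        (treeSeries * PowerSeries.derivative ℝ treeSeries) = treeDeriv (n + 1) / 2 := by
      intro n
      have h := congrArg (PowerSeries.coeff (n + 1)) derivative_treeSeries
      rw [mul_assoc, two_eq_C, map_add, PowerSeries.coeff_C_mul, PowerSeries.coeff_one,
        if_neg n.succ_ne_zero] at h
      rw [treeDeriv]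
      linarith
    simp only [h, evalQuarter_treeSeries]
    convert tendsto_treeDeriv_succ_div.div_const 2 using 2
    · ring
    · norm_num
  simp only [coeff_succ_mul_derivative, h0, h0', Finset.sum_div, mul_div_assoc] at htot ⊢
  exact tendsto_sum_range_of_le
    (fun n i => mul_nonneg (dominated_rootSeries k _).1 (div_pos (hpos _) (hpos _)).le)
    (fun n i => mul_le_mul_of_nonneg_right (dominated_rootSeries k _).2
      (div_pos (hpos _) (hpos _)).le)
    (fun i => (tendsto_treeDeriv_sub_div i).const_mul _)
    (fun i => (tendsto_treeDeriv_sub_div i).const_mul _)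
    (hasSum_coeff_succ (dominated_rootSeries k) h0)
    (hasSum_coeff_succ dominated_treeSeries h0') htot

theorem protectedProb_succ (k n : ℕ) :
    protectedProb k (n + 1) = PowerSeries.coeff (n + 1) (vertexSeries k) / treeDeriv n := by
  rw [treeDeriv_eq, treeSeries, vertexSeries, coeff_genFun, coeff_genFun, protectedProb,
    Finset.sum_div]
  refine Finset.sum_congr rfl fun t ht => ?_
  rw [mem_ofSize.1 ht]
  simp only [Pi.one_apply, Finset.sum_const, nsmul_eq_mul, mul_one]
  push_cast
  rw [div_mul_div_comm, one_mul]

theorem tendsto_protectedProb (k : ℕ) :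
    Tendsto (protectedProb k) atTop (𝓝 (3 / (4 ^ k + 2))) := by
  rw [← tendsto_add_atTop_iff_nat 1]
  have hsmall : Tendsto (fun n => PowerSeries.coeff (n + 1) (rootSeries k) / treeDeriv n)
      atTop (𝓝 0) := by
    refine squeeze_zero (fun n => div_nonneg (dominated_rootSeries k _).1 (treeDeriv_pos n).le)
      (fun n => ?_) (tendsto_one_div_add_atTop_nhds_zero_nat (𝕜 := ℝ))
    have hn : (0 : ℝ) < n + 1 := by positivity
    rw [div_le_div_iff₀ (treeDeriv_pos n) hn, one_mul, treeDeriv_eq]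
    exact mul_le_mul_of_nonneg_right (dominated_rootSeries k _).2 hn.le
  have h := ((tendsto_coeff_mul_derivative k).add hsmall).div_const 2
  rw [evalQuarter_rootSeries] at h
  convert h using 2 with n
  · have h2 := congrArg (PowerSeries.coeff (n + 1)) (two_mul_vertexSeries k)
    rw [two_eq_C, PowerSeries.coeff_C_mul, map_add] at h2
    rw [protectedProb_succ, ← add_div, ← h2]
    ring
  · have hk : (0 : ℝ) < 4 ^ k := by positivity
    field_simp
    norm_num

end PlaneTree

theorem corollary1 (k : ℕ) :
    Asymptotics.IsEquivalent Filter.atTop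
      (fun n : ℕ => PlaneTree.protectedProb k n)
      (fun _ : ℕ => (3 : ℝ) / ((4 : ℝ) ^ k + 2)) := by
  exact (Asymptotics.isEquivalent_const_iff_tendsto (by positivity)).2
    (PlaneTree.tendsto_protectedProb k)
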